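/- **Conventions.** Let $\xi,\Delta>0$ and let $M,m\ge 0$ be integers (in the protocol, $m<M$). Put $s_n=\sqrt{2^{\,n-M}}$ for integers $n\ge 0$. A mode has quadratures $\hat q,\hat p$ with $[\hat q,\hat p]=i$ and is described by its momentum wave function in $L^2(\mathbb R)$. For $u,v\in[-\pi,\pi)$ the shifted grid state is the tempered distribution $$|u,v,n\rangle=\frac{\sqrt{s_n\xi}}{2\pi}\sum_{s\in\mathbb Z}e^{iv\left(s+\frac{u}{2\pi}\right)}\,\bigl|p=s_n\xi\,(s+\tfrac{u}{2\pi})\bigr\rangle ,$$ where $|p=p_0\rangle$ is the Dirac distribution at $p_0$. Let $I_0(\kappa)=\sum_{k\ge0}(\kappa/2)^{2k}/(k!)^2$ be the modified Bessel function of order $0$, and let $$V_\kappa(x)=\frac{e^{\frac{\kappa}{2}\cos x}}{\sqrt{2\pi I_0(\kappa)}},\qquad G_\sigma(v)=\frac{e^{-v^2/(2\sigma^2)}}{\sqrt{\sigma\sqrt\pi}} .$$ For $\kappa\ge0$ and $\mu\in\mathbb R$ define $$|V_{\kappa,\mu,n}\rangle=\frac1{\mathcal N_{\kappa,\mu,n}}\int_{-\pi}^{\pi}\!du\int_{-\pi}^{\pi}\!dv\;\theta_{\kappa,\mu,n}(u,v)\,|u,v,n\rangle,\qquad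 \theta_{\kappa,\mu,n}(u,v)=V_\kappa(u-\mu)\sum_{s\in\mathbb Z}e^{ius}G_{s_n\Delta}(v+2\pi s),$$ $$\mathcal N_{\kappa,\mu,n}=\Bigl(\int_{-\pi}^{\pi}\!du\int_{-\pi}^{\pi}\!dv\;|\theta_{\kappa,\mu,n}(u,v)|^2\Bigr)^{1/2},$$ the superposition being understood in the sense of tempered distributions (pairing with every Schwartz function). **Claim.** 1. For all integers $n\ge 0$, $\kappa\ge0$ and $\mu\in\mathbb R$ one has $\mathcal N_{\kappa,\mu,n}>0$, and $|V_{\kappa,\mu,n}\rangle$ is a well-defined unit vector of $L^2(\mathbb R)$: there is exactly one element of $L^2(\mathbb R)$ that agrees with the superposition above, and it has norm $1$. 2. Let $\kappa_1,\kappa_2\ge0$ and $\mu_1,\mu_2\in\mathbb R$. Put mode 1 in the state $|V_{\kappa_1,\mu_1,m}\rangle$ and mode 2 in the state $|V_{\kappa_2,\mu_2,m}\rangle$, and apply the 50:50 beam splitter $$\mathcal B|p_1\rangle|p_2\rangle=\Bigl|\tfrac{p_1+p_2}{\sqrt2}\Bigr\rangle\Bigl|\tfrac{p_2-p_1}{\sqrt2}\Bigr\rangle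 ,$$ for which $\mathcal B\hat x_1\mathcal B^\dagger=(\hat x_1-\hat x_2)/\sqrt2$ and $\mathcal B\hat x_2\mathcal B^\dagger=(\hat x_1+\hat x_2)/\sqrt2$ with $\hat x=\hat q$ and with $\hat x=\hat p$. Then measure $\hat p_2$ by homodyne detection. For every outcome $p_{\rm out}\in\mathbb R$ put $\tilde p=\dfrac{2\pi p_{\rm out}}{\xi s_{m+1}}$. The normalized state of mode 1 after the outcome $p_{\rm out}$ is exactly $|V_{\kappa_{\rm out},\mu_{\rm out},m+1}\rangle$, where $\kappa_{\rm out}\ge 0$, $$\kappa_{\rm out}^2=\kappa_1^2+\kappa_2^2+2\kappa_1\kappa_2\cos(\mu_1-\mu_2+2\tilde p),$$ $$\mu_{\rm out}=\operatorname{atan2}\bigl(\kappa_1\sin(\mu_1+\tilde p)+\kappa_2\sin(\mu_2-\tilde p),\ \kappa_1\cos(\mu_1+\tilde p)+\kappa_2\cos(\mu_2-\tilde p)\bigr).$$ Here $\operatorname{atan2}(y,x)\in(-\pi,\pi]$ is the polar angle of the point $(x,y)$, with $\operatorname{atan2}(0,0)=0$. 3. The probability density of the outcome $p_{\rm out}$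 is strictly positive everywhere, is integrable with integral $1$, and equals $$\mathbb P(p_{\rm out})=\frac{\Delta\, I_0(\kappa_{\rm out})\,\mathcal N_{\kappa_{\rm out},\mu_{\rm out},m+1}^2}{\sqrt\pi\,\xi\, I_0(\kappa_1)I_0(\kappa_2)\,\mathcal N_{\kappa_1,\mu_1,m}^2\,\mathcal N_{\kappa_2,\mu_2,m}^2}\;e^{-p_{\rm out}^2\Delta^2/\xi^2},$$ with $\kappa_{\rm out},\mu_{\rm out}$ as in part 2. -/

import Mathlib

noncomputable section

open MeasureTheory

namespace GridBreeding

/-- The modified Bessel function of the first kind of order zero,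
`I₀(x) = ∑ₖ (x / 2)^(2k) / (k!)²`. -/
def besselI0 (x : ℝ) : ℝ :=
  ∑' k : ℕ, (x / 2) ^ (2 * k) / ((k.factorial : ℝ) ^ 2)

/-- The von Mises wave function `V_κ(x) = exp ((κ / 2) cos x) / √(2 π I₀(κ))`. -/
def vonMises (κ x : ℝ) : ℝ :=
  Real.exp (κ / 2 * Real.cos x) / √(2 * Real.pi * besselI0 κ)

/-- The Gaussian wave function `G_σ(v) = exp (-v² / (2 σ²)) / √(σ √π)`. -/
def gaussianWave (σ v : ℝ) : ℝ :=
  Real.exp (-(v ^ 2 / (2 * σ ^ 2))) / √(σ * √Real.pi)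

/-- The scale parameter `s_m = √(2^(m - M))` of round `m` in a protocol with `M` rounds. -/
def scale (M m : ℕ) : ℝ :=
  √((2 : ℝ) ^ ((m : ℤ) - (M : ℤ)))

/-- The shifted grid state with shifts `u, v` and momentum spacing `a` (here `a = s_m ξ`),
`|u, v⟩ = (√a / 2π) ∑ₛ exp (i v (s + u / 2π)) |p = a (s + u / 2π)⟩`.
It is not a vector of the Hilbert space but a tempered distribution in the momentum variable:
a momentum eigenstate `|p = p₀⟩` is the Dirac distribution `f ↦ f p₀` at `p₀`. -/
def shiftedGridKet (a u v : ℝ) (f : SchwartzMap ℝ ℂ) : ℂ :=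
  ((√a / (2 * Real.pi) : ℝ) : ℂ) *
    ∑' s : ℤ, Complex.exp (Complex.I * ((v * (s + u / (2 * Real.pi)) : ℝ) : ℂ)) *
      f (a * (s + u / (2 * Real.pi)))

/-- A momentum wave function `ψ ∈ L²(ℝ)` is the superposition
`∫_{-π}^{π} du ∫_{-π}^{π} dv Θ(u, v) |u, v⟩` of shifted grid states: the two sides agree as
tempered distributions, i.e. when they are paired with any Schwartz function. -/
def IsShiftedGridSuperposition (a : ℝ) (Θ : ℝ → ℝ → ℂ) (ψ : ℝ → ℂ) : Prop :=
  MemLp ψ 2 volume ∧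
    ∀ f : SchwartzMap ℝ ℂ,
      ∫ p : ℝ, ψ p * f p =
        ∫ u in (-Real.pi)..Real.pi, ∫ v in (-Real.pi)..Real.pi, Θ u v * shiftedGridKet a u v f

/-- The wave function in the shifts `u, v` before normalization: von Mises in `u`, wrapped
Gaussian of width `σ` in `v`, namely `V_κ(u - μ) ∑ₛ exp (i u s) G_σ(v + 2 π s)`. -/
def unnormalizedWave (σ κ μ u v : ℝ) : ℂ :=
  (vonMises κ (u - μ) : ℂ) *
    ∑' s : ℤ, Complex.exp (Complex.I * ((u * s : ℝ) : ℂ)) *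
      (gaussianWave σ (v + 2 * Real.pi * s) : ℂ)

/-- The normalization constant `𝒩`, the `L²` norm of `unnormalizedWave` on `[-π, π]²`. -/
def normConst (σ κ μ : ℝ) : ℝ :=
  √(∫ u in (-Real.pi)..Real.pi, ∫ v in (-Real.pi)..Real.pi, ‖unnormalizedWave σ κ μ u v‖ ^ 2)

/-- `ψ` is the momentum wave function of the approximate grid state `|V_{κ, μ, m}⟩` with final
spacing `ξ`, initial squeezing `Δ` and `M` rounds. -/
def IsVonMisesGridState (ξ Δ : ℝ) (M m : ℕ) (κ μ : ℝ) (ψ : ℝ → ℂ) : Prop :=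
  IsShiftedGridSuperposition (scale M m * ξ)
    (fun u v => ((normConst (scale M m * Δ) κ μ : ℝ) : ℂ)⁻¹ *
      unnormalizedWave (scale M m * Δ) κ μ u v) ψ

/-- The two-mode momentum wave function of the product state `|ψ₁⟩|ψ₂⟩`. -/
def productState (ψ₁ ψ₂ : ℝ → ℂ) : ℝ × ℝ → ℂ :=
  fun P => ψ₁ P.1 * ψ₂ P.2

/-- The 50:50 beam splitter `B` on two-mode momentum wave functions,
`B |p₁⟩|p₂⟩ = |(p₁ + p₂) / √2⟩ |(p₂ - p₁) / √2⟩`. Conjugation `X ↦ B X B†` sends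
`p₁ ↦ (p₁ - p₂) / √2` and `p₂ ↦ (p₁ + p₂) / √2`, and likewise the position quadratures
`q₁ ↦ (q₁ - q₂) / √2` and `q₂ ↦ (q₁ + q₂) / √2` (`q` acts as `i d/dp`). -/
def beamSplitter (Ψ : ℝ × ℝ → ℂ) : ℝ × ℝ → ℂ :=
  fun P => Ψ ((P.1 - P.2) / √2, (P.1 + P.2) / √2)

/-- Born density of the outcome `p` of a homodyne measurement of the momentum quadrature of mode
`2` in the two-mode momentum wave function `Ψ`. -/
def homodyneDensity (Ψ : ℝ × ℝ → ℂ) (p : ℝ) : ℝ :=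
  ∫ P : ℝ, ‖Ψ (P, p)‖ ^ 2

/-- The normalized state of mode `1` after outcome `p`: the partial inner product of `Ψ` with
`⟨p₂ = p|`, divided by its norm. -/
def postMeasurementState (Ψ : ℝ × ℝ → ℂ) (p : ℝ) : ℝ → ℂ :=
  fun P => ((√(homodyneDensity Ψ p) : ℝ) : ℂ)⁻¹ * Ψ (P, p)

/-- The rescaled outcome `2 π p / (ξ s_m)`. -/
def rescaledOutcome (ξ : ℝ) (M m : ℕ) (p : ℝ) : ℝ :=
  2 * Real.pi * p / (ξ * scale M m)

/-- The two-argument arctangent: the angle in `(-π, π]` of the point `(x, y)`, and `0` at the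
origin. -/
def atan2 (y x : ℝ) : ℝ :=
  Complex.arg ⟨x, y⟩

/-- The outgoing concentration, as a function of the rescaled outcome `t`. -/
def kappaOut (κ₁ κ₂ μ₁ μ₂ t : ℝ) : ℝ :=
  √(κ₁ ^ 2 + κ₂ ^ 2 + 2 * κ₁ * κ₂ * Real.cos (μ₁ - μ₂ + 2 * t))

/-- The outgoing mean, as a function of the rescaled outcome `t`. -/
def muOut (κ₁ κ₂ μ₁ μ₂ t : ℝ) : ℝ :=
  atan2 (κ₁ * Real.sin (μ₁ + t) + κ₂ * Real.sin (μ₂ - t))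
    (κ₁ * Real.cos (μ₁ + t) + κ₂ * Real.cos (μ₂ - t))

end GridBreeding

end

noncomputable section

open MeasureTheory Real

namespace GridBreeding

theorem hasSum_integral_comp_add_two_pi_mul_int {E : Type*} [NormedAddCommGroup E] [NormedSpace ℝ E]
    {g : ℝ → E} (hg : Integrable g) :
    HasSum (fun k : ℤ => ∫ x in (-π)..π, g (x + 2 * π * k)) (∫ x, g x) := by
  have hπ : (2 * π : ℝ) ≠ 0 := by positivity
  have hf : Integrable (fun y : ℝ => g (2 * π * y + -π)) :=
    (hg.comp_add_right (-π)).comp_mul_left' hπ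
  have h := hf.hasSum_intervalIntegral_comp_add_int.const_smul (2 * π)
  have e1 : (2 * π) • ∫ y : ℝ, g (2 * π * y + -π) = ∫ x, g x := by
    rw [Measure.integral_comp_mul_left (fun x => g (x + -π)) (2 * π),
      integral_add_right_eq_self g, abs_of_pos (by positivity), smul_smul, mul_inv_cancel₀ hπ,
      one_smul]
  rw [e1] at h
  convert h using 2 with k
  have e2 : ∀ x : ℝ, g (2 * π * (x + k) + -π) = (fun x => g (x + 2 * π * k)) (2 * π * x + -π) := by
    intro x
    simp only
    congr 1
    ring
  rw [intervalIntegral.integral_congr (fun x _ => e2 x)]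
  rw [intervalIntegral.integral_comp_mul_add (fun x => g (x + 2 * π * k)) hπ, smul_smul, mul_inv_cancel₀ hπ, one_smul]
  congr 1 <;> ring

theorem summable_integral_norm_comp_add_two_pi_mul_int {E : Type*} [NormedAddCommGroup E]
    {g : ℝ → E} (hg : Integrable g) :
    Summable fun k : ℤ => ∫ x in Set.Ioc (-π) π, ‖g (x + 2 * π * k)‖ := by
  have h := (hasSum_integral_comp_add_two_pi_mul_int hg.norm).summable
  simpa only [intervalIntegral.integral_of_le (neg_le_self pi_pos.le)] using h

/-- Unfolding: the integral over one period of the periodization is the integral over the line. -/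
theorem integral_tsum_comp_add_two_pi_mul_int {E : Type*} [NormedAddCommGroup E] [NormedSpace ℝ E]
    {g : ℝ → E} (hg : Integrable g) :
    ∫ x in (-π)..π, ∑' k : ℤ, g (x + 2 * π * k) = ∫ x, g x := by
  have h := hasSum_integral_of_summable_integral_norm
    (μ := volume.restrict (Set.Ioc (-π) π)) (F := fun (k : ℤ) x => g (x + 2 * π * k))
    (fun k => (hg.comp_add_right (2 * π * k)).integrableOn)
    (summable_integral_norm_comp_add_two_pi_mul_int hg)
  have h' := hasSum_integral_comp_add_two_pi_mul_int hg
  simp only [intervalIntegral.integral_of_le (neg_le_self pi_pos.le)] at h' ⊢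
  exact h.unique h'

/-- The Fourier transform of `gaussianWave σ`. -/
def gaussianHat (σ x : ℝ) : ℝ :=
  √(2 * √π * σ) * Real.exp (-(σ ^ 2 * x ^ 2 / 2))

/-- The twisted periodization of the Gaussian that occurs in `unnormalizedWave`. -/
def wrappedGaussian (σ u v : ℝ) : ℂ :=
  ∑' s : ℤ, Complex.exp (Complex.I * ((u * s : ℝ) : ℂ)) * (gaussianWave σ (v + 2 * π * s) : ℂ)

theorem continuous_gaussianWave (σ : ℝ) : Continuous (gaussianWave σ) := by
  unfold gaussianWave; fun_prop

theorem continuous_gaussianHat (σ : ℝ) : Continuous (gaussianHat σ) := by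
  unfold gaussianHat; fun_prop

theorem norm_exp_I_mul_ofReal (x : ℝ) : ‖Complex.exp (Complex.I * (x : ℂ))‖ = 1 := by
  rw [mul_comm]; exact Complex.norm_exp_ofReal_mul_I x

theorem integrable_gaussianWave {σ : ℝ} (hσ : 0 < σ) : Integrable (gaussianWave σ) := by
  have h : Integrable fun v : ℝ => Real.exp (-(2 * σ ^ 2)⁻¹ * v ^ 2) :=
    integrable_exp_neg_mul_sq (by positivity)
  refine (h.div_const (√(σ * √π))).congr (Filter.Eventually.of_forall fun v => ?_)
  simp only [gaussianWave]
  congr 2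
  field_simp

theorem integral_gaussianWave_mul_exp {σ : ℝ} (hσ : 0 < σ) (x : ℝ) :
    ∫ v : ℝ, (gaussianWave σ v : ℂ) * Complex.exp (Complex.I * ((v * x : ℝ) : ℂ)) =
      (gaussianHat σ x : ℂ) := by
  have hb : 0 < (((2 * σ ^ 2)⁻¹ : ℝ) : ℂ).re := by
    rw [Complex.ofReal_re]; positivity
  have h := fourierIntegral_gaussian hb (x : ℂ)
  have e : ∀ v : ℝ, (gaussianWave σ v : ℂ) * Complex.exp (Complex.I * ((v * x : ℝ) : ℂ)) =
      ((√(σ * √π))⁻¹ : ℝ) * (Complex.exp (Complex.I * x * v) *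
        Complex.exp (-(((2 * σ ^ 2)⁻¹ : ℝ) : ℂ) * (v : ℂ) ^ 2)) := by
    intro v
    simp only [gaussianWave]
    push_cast
    rw [div_eq_inv_mul, mul_assoc, mul_comm (Complex.exp (-_))]
    congr 3
    · ring_nf
    · field_simp
  simp_rw [e]
  rw [integral_const_mul, h]
  have e1 : ((π : ℂ) / (((2 * σ ^ 2)⁻¹ : ℝ) : ℂ)) ^ (1 / 2 : ℂ) = ((√(2 * π * σ ^ 2) : ℝ) : ℂ) := by
    rw [Real.sqrt_eq_rpow, Complex.ofReal_cpow (by positivity)]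
    congr 1
    · push_cast; field_simp
    · push_cast; rfl
  have e2 : -(x : ℂ) ^ 2 / (4 * (((2 * σ ^ 2)⁻¹ : ℝ) : ℂ)) = ((-(σ ^ 2 * x ^ 2 / 2) : ℝ) : ℂ) := by
    push_cast; field_simp; ring
  rw [e1, e2, ← Complex.ofReal_exp, ← Complex.ofReal_mul, ← Complex.ofReal_mul, ← mul_assoc,
    gaussianHat, ← Real.sqrt_inv, ← Real.sqrt_mul (by positivity)]
  have h3 : (σ * √π)⁻¹ * (2 * π * σ ^ 2) = 2 * √π * σ := by
    rw [inv_mul_eq_iff_eq_mul₀ (by positivity)]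
    linear_combination (-2 * σ ^ 2) * Real.sq_sqrt pi_pos.le
  rw [h3]

theorem integrable_gaussianWave_mul_exp {σ : ℝ} (hσ : 0 < σ) (x : ℝ) :
    Integrable fun v : ℝ =>
      (gaussianWave σ v : ℂ) * Complex.exp (Complex.I * ((v * x : ℝ) : ℂ)) := by
  refine (integrable_gaussianWave hσ).mono' ?_ (Filter.Eventually.of_forall fun v => ?_)
  · have := continuous_gaussianWave σ
    exact Continuous.aestronglyMeasurable (by fun_prop)
  · rw [norm_mul, norm_exp_I_mul_ofReal, mul_one, Complex.norm_real, Real.norm_eq_abs,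
      abs_of_nonneg]
    unfold gaussianWave; positivity

theorem exp_two_pi_shift (u v : ℝ) (k s : ℤ) :
    Complex.exp (Complex.I * (((v + 2 * π * k) * (s + u / (2 * π)) : ℝ) : ℂ)) =
      Complex.exp (Complex.I * ((u * k : ℝ) : ℂ)) *
        Complex.exp (Complex.I * ((v * (s + u / (2 * π)) : ℝ) : ℂ)) := by
  rw [← Complex.exp_add, Complex.exp_eq_exp_iff_exists_int]
  refine ⟨k * s, ?_⟩
  have : (π : ℂ) ≠ 0 := by exact_mod_cast pi_ne_zero
  push_cast
  field_simp
  ring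

theorem wrappedGaussian_mul_exp (σ u v : ℝ) (s : ℤ) :
    wrappedGaussian σ u v * Complex.exp (Complex.I * ((v * (s + u / (2 * π)) : ℝ) : ℂ)) =
      ∑' k : ℤ, (gaussianWave σ (v + 2 * π * k) : ℂ) *
        Complex.exp (Complex.I * (((v + 2 * π * k) * (s + u / (2 * π)) : ℝ) : ℂ)) := by
  rw [wrappedGaussian, ← tsum_mul_right]
  congr 1 with k
  rw [exp_two_pi_shift]
  ring

theorem integral_wrappedGaussian_mul_exp {σ : ℝ} (hσ : 0 < σ) (u : ℝ) (s : ℤ) :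
    ∫ v in (-π)..π, wrappedGaussian σ u v *
        Complex.exp (Complex.I * ((v * (s + u / (2 * π)) : ℝ) : ℂ)) =
      (gaussianHat σ (s + u / (2 * π)) : ℂ) := by
  simp_rw [wrappedGaussian_mul_exp]
  rw [← integral_gaussianWave_mul_exp hσ]
  exact integral_tsum_comp_add_two_pi_mul_int (integrable_gaussianWave_mul_exp hσ _)

theorem gaussianHat_abs_le (σ x : ℝ) : |gaussianHat σ x| ≤ √(2 * √π * σ) := by
  unfold gaussianHat
  rw [abs_of_nonneg (by positivity)]
  refine mul_le_of_le_one_right (by positivity) (Real.exp_le_one_iff.2 ?_)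
  have : 0 ≤ σ ^ 2 * x ^ 2 / 2 := by positivity
  linarith

/-- Poisson summation for the wrapped Gaussian. -/
theorem wrappedGaussian_eq_tsum {σ : ℝ} (hσ : 0 < σ) (u v : ℝ) :
    wrappedGaussian σ u v = ∑' s : ℤ,
      Complex.exp (-(Complex.I * ((v * (s + u / (2 * π)) : ℝ) : ℂ))) *
        ((2 * π)⁻¹ * gaussianHat σ (s + u / (2 * π)) : ℝ) := by
  have hπ : (π : ℂ) ≠ 0 := by exact_mod_cast pi_ne_zero
  have hσ' : (σ : ℂ) ≠ 0 := by exact_mod_cast hσ.ne'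
  have ha : 0 < ((2 * π / σ ^ 2 : ℝ) : ℂ).re := by rw [Complex.ofReal_re]; positivity
  have h := Complex.tsum_exp_neg_quadratic ha (Complex.I * u / (2 * π) - v / σ ^ 2)
  have hc : 1 / ((2 * π / σ ^ 2 : ℝ) : ℂ) ^ (1 / 2 : ℂ) = ((√(σ ^ 2 / (2 * π)) : ℝ) : ℂ) := by
    rw [← inv_div (2 * π) (σ ^ 2), Real.sqrt_inv, Real.sqrt_eq_rpow]
    rw [Complex.ofReal_inv, Complex.ofReal_cpow (by positivity), one_div]
    push_cast; rfl
  have hconst : (√(σ * √π))⁻¹ * √(σ ^ 2 / (2 * π)) = (2 * π)⁻¹ * √(2 * √π * σ) := by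
    have h2 : (2 * π)⁻¹ = √((2 * π)⁻¹ ^ 2) := (Real.sqrt_sq (by positivity)).symm
    rw [h2, ← Real.sqrt_inv, ← Real.sqrt_mul (by positivity), ← Real.sqrt_mul (by positivity)]
    congr 1
    have : π = √π * √π := (Real.mul_self_sqrt pi_pos.le).symm
    have h3 : √π ≠ 0 := by positivity
    field_simp
    nlinarith
  have hl : ∀ s : ℤ, Complex.exp (Complex.I * ((u * s : ℝ) : ℂ)) *
      (gaussianWave σ (v + 2 * π * s) : ℂ) =
      ((√(σ * √π))⁻¹ * Real.exp (-(v ^ 2 / (2 * σ ^ 2))) : ℝ) *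
        Complex.exp (-π * ((2 * π / σ ^ 2 : ℝ) : ℂ) * (s : ℂ) ^ 2 +
          2 * π * (Complex.I * u / (2 * π) - v / σ ^ 2) * s) := by
    intro s
    rw [gaussianWave, div_eq_inv_mul]
    simp only [Complex.ofReal_mul, Complex.ofReal_inv, Complex.ofReal_exp]
    push_cast
    rw [mul_left_comm, mul_assoc, ← Complex.exp_add, mul_assoc, ← Complex.exp_add]
    congr 2
    field_simp
    ring
  have hr : ∀ s : ℤ, Complex.exp (-(Complex.I * ((v * (s + u / (2 * π)) : ℝ) : ℂ))) *
        ((2 * π)⁻¹ * gaussianHat σ (s + u / (2 * π)) : ℝ) =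
      ((√(σ * √π))⁻¹ * Real.exp (-(v ^ 2 / (2 * σ ^ 2))) * √(σ ^ 2 / (2 * π)) : ℝ) *
        Complex.exp (-π / ((2 * π / σ ^ 2 : ℝ) : ℂ) * (((-s : ℤ) : ℂ) +
          Complex.I * (Complex.I * u / (2 * π) - v / σ ^ 2)) ^ 2) := by
    intro s
    rw [gaussianHat, ← mul_assoc, ← hconst]
    push_cast
    have : ∀ A B C D E : ℂ, A * (B * C * D) = B * E * C * (A * D * E⁻¹) ∨ E = 0 := by
      intro A B C D E
      by_cases hE : E = 0
      · exact Or.inr hE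
      · left; field_simp
    rw [(this _ _ _ _ (Complex.exp (-((v : ℂ) ^ 2 / (2 * σ ^ 2))))).resolve_right
      (Complex.exp_ne_zero _), ← Complex.exp_neg, ← Complex.exp_add, ← Complex.exp_add]
    congr 2
    field_simp
    ring_nf
    simp only [Complex.I_sq, Complex.I_pow_three, Complex.I_pow_four]
    ring
  rw [wrappedGaussian]
  simp_rw [hl, hr]
  rw [tsum_mul_left, tsum_mul_left, h, hc, ← (Equiv.neg ℤ).tsum_eq (fun s : ℤ =>
    Complex.exp (-π / ((2 * π / σ ^ 2 : ℝ) : ℂ) * ((s : ℂ) +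
          Complex.I * (Complex.I * u / (2 * π) - v / σ ^ 2)) ^ 2))]
  simp only [Equiv.neg_apply]
  push_cast
  ring

theorem summable_norm_int_add_of_isBigO {E : Type*} [NormedAddCommGroup E] {f : ℝ → E}
    (hf : f =O[Filter.cocompact ℝ] fun x => ‖x‖ ^ (-2 : ℝ)) (x : ℝ) :
    Summable fun s : ℤ => ‖f (s + x)‖ := by
  have ht : Filter.Tendsto (fun s : ℤ => (s : ℝ) + x) Filter.cofinite (Filter.cocompact ℝ) :=
    (Homeomorph.addRight x).isClosedEmbedding.tendsto_cocompact.comp Int.tendsto_coe_cofinite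
  refine summable_of_isBigO ((Real.summable_one_div_int_add_rpow x 2).2 (by norm_num)) ?_
  refine ((hf.comp_tendsto ht).norm_left).congr_right fun s => ?_
  simp

theorem SchwartzMap.summable_norm_mul_int_add (f : SchwartzMap ℝ ℂ) {a : ℝ} (ha : a ≠ 0) (x : ℝ) :
    Summable fun s : ℤ => ‖f (a * (s + x))‖ := by
  refine summable_norm_int_add_of_isBigO (f := fun y => f (a * y)) ?_ x
  have ht : Filter.Tendsto (fun y : ℝ => a * y) (Filter.cocompact ℝ) (Filter.cocompact ℝ) :=
    (Homeomorph.mulLeft₀ a ha).isClosedEmbedding.tendsto_cocompact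
  refine ((f.isBigO_cocompact_rpow (-2)).comp_tendsto ht).trans ?_
  refine Asymptotics.IsBigO.of_bound (|a| ^ (-2 : ℝ)) (Filter.Eventually.of_forall fun y => ?_)
  simp only [Function.comp, norm_mul, Real.norm_eq_abs]
  rw [Real.mul_rpow (abs_nonneg _) (abs_nonneg _), abs_mul,
    abs_of_nonneg (Real.rpow_nonneg (abs_nonneg a) _)]

theorem gaussianHat_nonneg (σ x : ℝ) : 0 ≤ gaussianHat σ x := by
  unfold gaussianHat; positivity

theorem summable_gaussianHat {σ : ℝ} (hσ : 0 < σ) (x : ℝ) :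
    Summable fun s : ℤ => gaussianHat σ (s + x) := by
  have h : (gaussianHat σ) =O[Filter.cocompact ℝ] fun x => ‖x‖ ^ (-2 : ℝ) := by
    have h1 := (isLittleO_exp_neg_mul_sq_cocompact (a := ((σ ^ 2 / 2 : ℝ) : ℂ))
      (by rw [Complex.ofReal_re]; positivity) (-2)).isBigO.norm_left
    refine (h1.const_mul_left (√(2 * √π * σ))).congr_left fun x => ?_
    rw [← Complex.ofReal_neg, ← Complex.ofReal_pow, ← Complex.ofReal_mul, Complex.norm_exp_ofReal]
    unfold gaussianHat
    congr 2
    ring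
  simpa only [Real.norm_eq_abs, abs_of_nonneg (gaussianHat_nonneg σ _)]
    using summable_norm_int_add_of_isBigO h x

theorem continuous_wrappedGaussian {σ : ℝ} (hσ : 0 < σ) (u : ℝ) :
    Continuous (wrappedGaussian σ u) := by
  have e : wrappedGaussian σ u = fun v => _ := funext (wrappedGaussian_eq_tsum hσ u)
  rw [e]
  refine continuous_tsum (fun s => by fun_prop)
    ((summable_gaussianHat hσ (u / (2 * π))).mul_left (2 * π)⁻¹) fun s v => ?_
  rw [norm_mul, ← mul_neg, ← Complex.ofReal_neg, norm_exp_I_mul_ofReal, one_mul,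
    Complex.norm_real, Real.norm_eq_abs, abs_of_nonneg]
  have := gaussianHat_nonneg σ (s + u / (2 * π))
  positivity

/-- Pairing the wrapped Gaussian with an absolutely convergent twisted Fourier series. -/
theorem integral_wrappedGaussian_mul_tsum {σ : ℝ} (hσ : 0 < σ) (u : ℝ) {c : ℤ → ℂ}
    (hc : Summable fun s => ‖c s‖) :
    ∫ v in (-π)..π, wrappedGaussian σ u v *
        ∑' s : ℤ, Complex.exp (Complex.I * ((v * (s + u / (2 * π)) : ℝ) : ℂ)) * c s =
      ∑' s : ℤ, (gaussianHat σ (s + u / (2 * π)) : ℂ) * c s := by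
  have hW := continuous_wrappedGaussian hσ u
  have h := hasSum_integral_of_summable_integral_norm
    (μ := volume.restrict (Set.Ioc (-π) π)) (F := fun (s : ℤ) v => wrappedGaussian σ u v *
      (Complex.exp (Complex.I * ((v * (s + u / (2 * π)) : ℝ) : ℂ)) * c s))
    (fun s => Continuous.integrableOn_Ioc (by fun_prop)) ?_
  · simp_rw [tsum_mul_left] at h
    rw [intervalIntegral.integral_of_le (neg_le_self pi_pos.le), ← h.tsum_eq]
    congr 1 with s
    rw [← integral_wrappedGaussian_mul_exp hσ, intervalIntegral.integral_of_le
      (neg_le_self pi_pos.le), ← integral_mul_const]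
    simp_rw [mul_assoc]
  · refine (hc.mul_left (∫ v in Set.Ioc (-π) π, ‖wrappedGaussian σ u v‖)).congr fun s => ?_
    rw [← integral_mul_const]
    simp_rw [norm_mul, norm_exp_I_mul_ofReal, one_mul]

theorem integral_norm_wrappedGaussian_sq {σ : ℝ} (hσ : 0 < σ) (u : ℝ) :
    ∫ v in (-π)..π, ‖wrappedGaussian σ u v‖ ^ 2 =
      ∑' s : ℤ, (2 * π)⁻¹ * gaussianHat σ (s + u / (2 * π)) ^ 2 := by
  have hc : Summable fun s : ℤ =>
      ‖(((2 * π)⁻¹ * gaussianHat σ (s + u / (2 * π)) : ℝ) : ℂ)‖ := by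
    simp only [Complex.norm_real]
    exact ((summable_gaussianHat hσ (u / (2 * π))).mul_left (2 * π)⁻¹).norm
  have h := integral_wrappedGaussian_mul_tsum hσ u hc
  have e : ∀ v : ℝ, wrappedGaussian σ u v *
      ∑' s : ℤ, Complex.exp (Complex.I * ((v * (s + u / (2 * π)) : ℝ) : ℂ)) *
        (((2 * π)⁻¹ * gaussianHat σ (s + u / (2 * π)) : ℝ) : ℂ) =
      ((‖wrappedGaussian σ u v‖ ^ 2 : ℝ) : ℂ) := by
    intro v
    rw [Complex.ofReal_pow, ← Complex.mul_conj']
    congr 1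
    rw [wrappedGaussian_eq_tsum hσ, Complex.conj_tsum]
    congr 1 with s
    rw [map_mul, Complex.conj_ofReal, ← Complex.exp_conj, map_neg, map_mul, Complex.conj_I,
      Complex.conj_ofReal, neg_mul, neg_neg]
  simp_rw [e] at h
  rw [intervalIntegral.integral_ofReal] at h
  apply Complex.ofReal_injective
  rw [h, Complex.ofReal_tsum]
  congr 1 with s
  push_cast
  ring

theorem continuous_vonMises (κ : ℝ) : Continuous (vonMises κ) := by
  unfold vonMises; fun_prop

theorem vonMises_nonneg (κ x : ℝ) : 0 ≤ vonMises κ x := by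
  unfold vonMises; positivity

theorem vonMises_le (κ x : ℝ) :
    vonMises κ x ≤ Real.exp (|κ / 2|) / √(2 * π * besselI0 κ) := by
  unfold vonMises
  gcongr
  calc κ / 2 * Real.cos x ≤ |κ / 2 * Real.cos x| := le_abs_self _
    _ = |κ / 2| * |Real.cos x| := abs_mul _ _
    _ ≤ |κ / 2| := mul_le_of_le_one_right (abs_nonneg _) (Real.abs_cos_le_one x)

theorem vonMises_add_two_pi_mul_int (κ x : ℝ) (s : ℤ) :
    vonMises κ (x + 2 * π * s) = vonMises κ x := by
  unfold vonMises
  rw [mul_comm (2 * π), Real.cos_add_int_mul_two_pi]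

/-- The momentum wave function of the superposition with coefficients `unnormalizedWave σ κ μ`. -/
def gridAmp (a σ κ μ p : ℝ) : ℝ :=
  (√a)⁻¹ * vonMises κ (2 * π * p / a - μ) * gaussianHat σ (p / a)

theorem continuous_gridAmp (a σ κ μ : ℝ) : Continuous (gridAmp a σ κ μ) := by
  have := continuous_vonMises κ
  have := continuous_gaussianHat σ
  unfold gridAmp; fun_prop

theorem integrable_gaussianHat {σ : ℝ} (hσ : 0 < σ) : Integrable (gaussianHat σ) := by
  have h : Integrable fun v : ℝ => Real.exp (-(σ ^ 2 / 2) * v ^ 2) :=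
    integrable_exp_neg_mul_sq (by positivity)
  refine (h.const_mul (√(2 * √π * σ))).congr (Filter.Eventually.of_forall fun v => ?_)
  simp only [gaussianHat]
  congr 2
  ring

theorem unnormalizedWave_eq (σ κ μ u v : ℝ) :
    unnormalizedWave σ κ μ u v = vonMises κ (u - μ) * wrappedGaussian σ u v := rfl

theorem integral_gridAmp_mul {a σ : ℝ} (ha : 0 < a) (hσ : 0 < σ) (κ μ : ℝ)
    (f : SchwartzMap ℝ ℂ) :
    ∫ p : ℝ, (gridAmp a σ κ μ p : ℂ) * f p =
      ∫ u in (-π)..π, ∫ v in (-π)..π, unnormalizedWave σ κ μ u v * shiftedGridKet a u v f := by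
  set h : ℝ → ℂ := fun x => ((√a / (2 * π) * vonMises κ (x - μ) * gaussianHat σ (x / (2 * π)) : ℝ)
    : ℂ) * f (a * (x / (2 * π))) with hdef
  have hh : Integrable h := by
    have hG : Integrable fun x => gaussianHat σ (x / (2 * π)) :=
      (integrable_gaussianHat hσ).comp_div (by positivity)
    obtain ⟨C, -, hC⟩ := f.decay 0 0
    simp only [pow_zero, one_mul, norm_iteratedFDeriv_zero] at hC
    have hf := f.continuous
    have hv := continuous_vonMises κ
    have hg := continuous_gaussianHat σ
    refine (hG.const_mul (√a / (2 * π) * (Real.exp (|κ / 2|) / √(2 * π * besselI0 κ)) * C)).mono'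
      (Continuous.aestronglyMeasurable (by fun_prop)) (Filter.Eventually.of_forall fun x => ?_)
    have h1 := gaussianHat_nonneg σ (x / (2 * π))
    have h2 := vonMises_nonneg κ (x - μ)
    have h3 := vonMises_le κ (x - μ)
    rw [hdef, norm_mul, Complex.norm_real, Real.norm_eq_abs, abs_of_nonneg (by positivity)]
    have h4 := hC (a * (x / (2 * π)))
    calc _ ≤ √a / (2 * π) * (Real.exp (|κ / 2|) / √(2 * π * besselI0 κ)) *
          gaussianHat σ (x / (2 * π)) * C := by gcongr
      _ = _ := by ring
  have hin : ∀ u : ℝ, ∫ v in (-π)..π, unnormalizedWave σ κ μ u v * shiftedGridKet a u v f =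
      ∑' s : ℤ, h (u + 2 * π * s) := by
    intro u
    have hB := integral_wrappedGaussian_mul_tsum hσ u
      (SchwartzMap.summable_norm_mul_int_add f ha.ne' (u / (2 * π)))
    have e : ∀ v, unnormalizedWave σ κ μ u v * shiftedGridKet a u v f =
        ((√a / (2 * π) * vonMises κ (u - μ) : ℝ) : ℂ) * (wrappedGaussian σ u v *
          ∑' s : ℤ, Complex.exp (Complex.I * ((v * (s + u / (2 * π)) : ℝ) : ℂ)) *
            f (a * (s + u / (2 * π)))) := by
      intro v
      rw [unnormalizedWave_eq, shiftedGridKet, Complex.ofReal_mul]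
      ring
    simp_rw [e]
    rw [intervalIntegral.integral_const_mul, hB, ← tsum_mul_left]
    congr 1 with s
    have e1 : (u + 2 * π * s) / (2 * π) = s + u / (2 * π) := by field_simp; ring
    simp only [hdef]
    rw [e1, show u + 2 * π * s - μ = u - μ + 2 * π * s by ring, vonMises_add_two_pi_mul_int,
      Complex.ofReal_mul _ (gaussianHat σ _)]
    ring
  simp_rw [hin]
  rw [integral_tsum_comp_add_two_pi_mul_int hh]
  have hs := Measure.integral_comp_mul_left h (2 * π / a)
  rw [abs_of_pos (by positivity), inv_div, eq_comm, ← eq_inv_smul_iff₀ (by positivity), inv_div,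
    ← integral_smul] at hs
  rw [hs]
  congr 1 with p
  simp only [hdef]
  have e1 : 2 * π / a * p / (2 * π) = p / a := by field_simp
  have e2 : a * (p / a) = p := by field_simp
  rw [e1, e2, Complex.real_smul, ← mul_assoc, ← Complex.ofReal_mul, gridAmp]
  congr 2
  rw [show 2 * π / a * p = 2 * π * p / a by ring]
  have e3 : 2 * π / a * (√a / (2 * π)) = (√a)⁻¹ := by
    rw [div_mul_div_comm, mul_comm a, mul_div_mul_left _ _ (by positivity), Real.sqrt_div_self',
      one_div]
  rw [← e3]
  ring

theorem integrable_gridAmp_sq {a σ : ℝ} (ha : 0 < a) (hσ : 0 < σ) (κ μ : ℝ) :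
    Integrable fun p => gridAmp a σ κ μ p ^ 2 := by
  have hG : Integrable fun p => gaussianHat σ (p / a) :=
    (integrable_gaussianHat hσ).comp_div ha.ne'
  refine (hG.const_mul (((√a)⁻¹ * (Real.exp (|κ / 2|) / √(2 * π * besselI0 κ))) ^ 2 *
    √(2 * √π * σ))).mono' ((continuous_gridAmp a σ κ μ).pow 2).aestronglyMeasurable
    (Filter.Eventually.of_forall fun p => ?_)
  have h1 := gaussianHat_nonneg σ (p / a)
  have h2 := vonMises_nonneg κ (2 * π * p / a - μ)
  have h3 := vonMises_le κ (2 * π * p / a - μ)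
  have h4 := (le_abs_self _).trans (gaussianHat_abs_le σ (p / a))
  rw [Real.norm_eq_abs, abs_of_nonneg (by positivity), gridAmp, mul_pow, sq (gaussianHat _ _),
    ← mul_assoc]
  gcongr

theorem normConst_sq {a σ : ℝ} (ha : 0 < a) (hσ : 0 < σ) (κ μ : ℝ) :
    normConst σ κ μ ^ 2 = ∫ p, gridAmp a σ κ μ p ^ 2 := by
  set h : ℝ → ℝ := fun x => a / (2 * π) * gridAmp a σ κ μ (a / (2 * π) * x) ^ 2 with hdef
  have hh : Integrable h :=
    ((integrable_gridAmp_sq ha hσ κ μ).comp_mul_left' (R := a / (2 * π))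
      (by positivity)).const_mul _
  have hin : ∀ u : ℝ, ∫ v in (-π)..π, ‖unnormalizedWave σ κ μ u v‖ ^ 2 =
      ∑' s : ℤ, h (u + 2 * π * s) := by
    intro u
    simp_rw [unnormalizedWave_eq, norm_mul, mul_pow]
    rw [intervalIntegral.integral_const_mul, integral_norm_wrappedGaussian_sq hσ, ← tsum_mul_left]
    congr 1 with s
    simp only [hdef, gridAmp]
    rw [Complex.norm_real, Real.norm_eq_abs, sq_abs,
      show 2 * π * (a / (2 * π) * (u + 2 * π * s)) / a - μ = u - μ + 2 * π * s by
        field_simp; ring, vonMises_add_two_pi_mul_int,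
      show a / (2 * π) * (u + 2 * π * s) / a = s + u / (2 * π) by field_simp; ring,
      mul_pow, mul_pow, inv_pow, Real.sq_sqrt ha.le]
    field_simp
  unfold normConst
  simp_rw [hin]
  rw [integral_tsum_comp_add_two_pi_mul_int hh, hdef, integral_const_mul,
    Measure.integral_comp_mul_left (fun x => gridAmp a σ κ μ x ^ 2) (a / (2 * π)),
    abs_of_pos (by positivity), smul_eq_mul, mul_inv_cancel_left₀ (by positivity),
    Real.sq_sqrt (integral_nonneg fun p => sq_nonneg _)]

theorem summable_besselI0 (x : ℝ) :
    Summable fun k : ℕ => (x / 2) ^ (2 * k) / ((k.factorial : ℝ) ^ 2) := by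
  refine Summable.of_nonneg_of_le (fun k => ?_) (fun k => ?_)
    (Real.summable_pow_div_factorial ((x / 2) ^ 2))
  · rw [pow_mul]; positivity
  · rw [pow_mul]
    have : (1 : ℝ) ≤ k.factorial := by exact_mod_cast k.factorial_pos
    gcongr
    nlinarith

theorem besselI0_pos (x : ℝ) : 0 < besselI0 x := by
  refine (summable_besselI0 x).tsum_pos (fun k => ?_) 0 (by simp)
  rw [pow_mul]; positivity

theorem gridAmp_eq {a σ : ℝ} (ha : 0 < a) (hσ : 0 < σ) (κ μ p : ℝ) :
    gridAmp a σ κ μ p = √(σ / (√π * a) / besselI0 κ) *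
      Real.exp (κ / 2 * Real.cos (2 * π * p / a - μ) - σ ^ 2 * p ^ 2 / (2 * a ^ 2)) := by
  have hI := besselI0_pos κ
  have e : √(σ / (√π * a) / besselI0 κ) =
      (√a)⁻¹ * (√(2 * π * besselI0 κ))⁻¹ * √(2 * √π * σ) := by
    rw [← Real.sqrt_inv, ← Real.sqrt_inv, ← Real.sqrt_mul (by positivity),
      ← Real.sqrt_mul (by positivity)]
    congr 1
    have h3 : √π ≠ 0 := by positivity
    have h4 : π = √π * √π := (Real.mul_self_sqrt pi_pos.le).symm
    rw [div_div, div_eq_iff (by positivity)]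
    nth_rw 1 [h4]
    field_simp
  rw [e, gridAmp, vonMises, gaussianHat, Real.exp_sub]
  have e2 : σ ^ 2 * (p / a) ^ 2 / 2 = σ ^ 2 * p ^ 2 / (2 * a ^ 2) := by field_simp
  rw [e2, Real.exp_neg]
  ring

theorem gridAmp_pos {a σ : ℝ} (ha : 0 < a) (hσ : 0 < σ) (κ μ p : ℝ) : 0 < gridAmp a σ κ μ p := by
  have hI := besselI0_pos κ
  rw [gridAmp_eq ha hσ]
  positivity

theorem normConst_pos {σ : ℝ} (hσ : 0 < σ) (κ μ : ℝ) : 0 < normConst σ κ μ := by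
  have h : 0 < normConst σ κ μ ^ 2 := by
    rw [normConst_sq one_pos hσ, integral_pos_iff_support_of_nonneg (fun p => sq_nonneg _)
      (integrable_gridAmp_sq one_pos hσ κ μ)]
    have : (Function.support fun p => gridAmp 1 σ κ μ p ^ 2) = Set.univ := by
      ext p
      simp [(gridAmp_pos one_pos hσ κ μ p).ne']
    rw [this]
    simp
  exact lt_of_le_of_ne (Real.sqrt_nonneg _) fun h0 => by simp [← h0] at h

theorem kappaOut_eq_norm (κ₁ κ₂ μ₁ μ₂ t : ℝ) :
    kappaOut κ₁ κ₂ μ₁ μ₂ t = ‖(⟨κ₁ * Real.cos (μ₁ + t) + κ₂ * Real.cos (μ₂ - t),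
      κ₁ * Real.sin (μ₁ + t) + κ₂ * Real.sin (μ₂ - t)⟩ : ℂ)‖ := by
  rw [Complex.norm_eq_sqrt_sq_add_sq, kappaOut]
  congr 1
  rw [show μ₁ - μ₂ + 2 * t = (μ₁ + t) - (μ₂ - t) by ring, Real.cos_sub]
  linear_combination (-κ₁ ^ 2) * Real.sin_sq_add_cos_sq (μ₁ + t) -
    κ₂ ^ 2 * Real.sin_sq_add_cos_sq (μ₂ - t)

theorem kappaOut_sq (κ₁ κ₂ μ₁ μ₂ t : ℝ) :
    kappaOut κ₁ κ₂ μ₁ μ₂ t ^ 2 =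
      κ₁ ^ 2 + κ₂ ^ 2 + 2 * κ₁ * κ₂ * Real.cos (μ₁ - μ₂ + 2 * t) := by
  refine Real.sq_sqrt ?_
  nlinarith [sq_nonneg (κ₁ + κ₂ * Real.cos (μ₁ - μ₂ + 2 * t)),
    mul_nonneg (sq_nonneg κ₂) (sq_nonneg (Real.sin (μ₁ - μ₂ + 2 * t))),
    Real.sin_sq_add_cos_sq (μ₁ - μ₂ + 2 * t)]

/-- Harmonic addition: the sum of two shifted cosines is a cosine of concentration `kappaOut`
and mean `muOut`. -/
theorem kappaOut_mul_cos (κ₁ κ₂ μ₁ μ₂ t x : ℝ) :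
    kappaOut κ₁ κ₂ μ₁ μ₂ t * Real.cos (x - muOut κ₁ κ₂ μ₁ μ₂ t) =
      κ₁ * Real.cos (x - t - μ₁) + κ₂ * Real.cos (x + t - μ₂) := by
  have h1 := Complex.norm_mul_cos_arg (⟨κ₁ * Real.cos (μ₁ + t) + κ₂ * Real.cos (μ₂ - t),
      κ₁ * Real.sin (μ₁ + t) + κ₂ * Real.sin (μ₂ - t)⟩ : ℂ)
  have h2 := Complex.norm_mul_sin_arg (⟨κ₁ * Real.cos (μ₁ + t) + κ₂ * Real.cos (μ₂ - t),
      κ₁ * Real.sin (μ₁ + t) + κ₂ * Real.sin (μ₂ - t)⟩ : ℂ)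
  rw [← kappaOut_eq_norm] at h1 h2
  rw [show x - t - μ₁ = x - (μ₁ + t) by ring, show x + t - μ₂ = x - (μ₂ - t) by ring,
    Real.cos_sub, Real.cos_sub, Real.cos_sub, muOut, atan2]
  linear_combination Real.cos x * h1 + Real.sin x * h2

theorem gridAmp_mul_gridAmp {a σ : ℝ} (ha : 0 < a) (hσ : 0 < σ) (κ₁ κ₂ μ₁ μ₂ P p t : ℝ)
    (ht : t = 2 * π * p / (√2 * a)) :
    gridAmp a σ κ₁ μ₁ ((P - p) / √2) * gridAmp a σ κ₂ μ₂ ((P + p) / √2) =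
      √(σ / (√π * a) * besselI0 (kappaOut κ₁ κ₂ μ₁ μ₂ t) / (besselI0 κ₁ * besselI0 κ₂)) *
        Real.exp (-(σ ^ 2 * p ^ 2 / (2 * a ^ 2))) *
        gridAmp (√2 * a) (√2 * σ) (kappaOut κ₁ κ₂ μ₁ μ₂ t) (muOut κ₁ κ₂ μ₁ μ₂ t) P := by
  have h2 : 0 < √2 := by positivity
  have hs : √2 ^ 2 = 2 := Real.sq_sqrt (by norm_num)
  have hI := besselI0_pos (kappaOut κ₁ κ₂ μ₁ μ₂ t)
  have hI1 := besselI0_pos κ₁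
  have hI2 := besselI0_pos κ₂
  have hc := kappaOut_mul_cos κ₁ κ₂ μ₁ μ₂ t (2 * π * P / (√2 * a))
  rw [gridAmp_eq ha hσ, gridAmp_eq ha hσ, gridAmp_eq (mul_pos h2 ha) (mul_pos h2 hσ),
    mul_mul_mul_comm, mul_mul_mul_comm (√(σ / (√π * a) * _ / _)), ← Real.exp_add, ← Real.exp_add,
    ← Real.sqrt_mul (by positivity), ← Real.sqrt_mul (by positivity)]
  congr 1
  · congr 1
    field_simp
  · congr 1
    have e1 : 2 * π * ((P - p) / √2) / a - μ₁ = 2 * π * P / (√2 * a) - t - μ₁ := by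
      rw [ht]; field_simp
    have e2 : 2 * π * ((P + p) / √2) / a - μ₂ = 2 * π * P / (√2 * a) + t - μ₂ := by
      rw [ht]; field_simp
    have e3 : ((P - p) / √2) ^ 2 + ((P + p) / √2) ^ 2 = P ^ 2 + p ^ 2 := by
      rw [div_pow, div_pow, hs]; ring
    have e4 : (√2 * σ) ^ 2 * P ^ 2 / (2 * (√2 * a) ^ 2) = σ ^ 2 * P ^ 2 / (2 * a ^ 2) := by
      rw [mul_pow, mul_pow, hs]; field_simp
    rw [e1, e2, e4]
    linear_combination (-1 / 2) * hc - σ ^ 2 / (2 * a ^ 2) * e3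

theorem IsShiftedGridSuperposition.ae_eq {a : ℝ} {Θ : ℝ → ℝ → ℂ} {ψ ψ' : ℝ → ℂ}
    (h : IsShiftedGridSuperposition a Θ ψ) (h' : IsShiftedGridSuperposition a Θ ψ') :
    ψ =ᵐ[volume] ψ' := by
  have hd : MemLp (ψ - ψ') 2 volume := h.1.sub h'.1
  have h0 : ∀ᵐ x, (ψ - ψ') x = 0 := by
    refine ae_eq_zero_of_integral_contDiff_smul_eq_zero
      (hd.locallyIntegrable (by norm_num)) fun g hg hgc => ?_
    have hg₁ : HasCompactSupport (Complex.ofRealCLM ∘ g) := hgc.comp_left rfl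
    have hg₂ : ContDiff ℝ (⊤ : ℕ∞) (Complex.ofRealCLM ∘ g) := Complex.ofRealCLM.contDiff.comp hg
    set f := hg₁.toSchwartzMap hg₂
    have hf : MemLp f 2 volume := f.memLp 2 volume
    calc ∫ x, g x • (ψ - ψ') x = ∫ x, (ψ x * f x - ψ' x * f x) := by
          congr 1 with x
          simp only [Complex.real_smul, Pi.sub_apply, f, HasCompactSupport.toSchwartzMap_toFun,
            Function.comp, Complex.ofRealCLM_apply]
          ring
      _ = 0 := by
          rw [integral_sub (f := fun x => ψ x * f x) (g := fun x => ψ' x * f x)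
            (h.1.integrable_mul hf) (h'.1.integrable_mul hf), h.2 f, h'.2 f,
            sub_self]
  filter_upwards [h0] with x hx using sub_eq_zero.1 hx

theorem IsShiftedGridSuperposition.congr_ae {a : ℝ} {Θ : ℝ → ℝ → ℂ} {ψ ψ' : ℝ → ℂ}
    (h : IsShiftedGridSuperposition a Θ ψ) (he : ψ' =ᵐ[volume] ψ) :
    IsShiftedGridSuperposition a Θ ψ' := by
  refine ⟨(memLp_congr_ae he).2 h.1, fun f => ?_⟩
  rw [← h.2 f]
  exact integral_congr_ae (by filter_upwards [he] with p hp; rw [hp])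

theorem isShiftedGridSuperposition_gridAmp {a σ : ℝ} (ha : 0 < a) (hσ : 0 < σ) (κ μ c : ℝ) :
    IsShiftedGridSuperposition a (fun u v => (c : ℂ)⁻¹ * unnormalizedWave σ κ μ u v)
      (fun p => ((c⁻¹ * gridAmp a σ κ μ p : ℝ) : ℂ)) := by
  constructor
  · refine MemLp.ofReal (MemLp.const_mul ?_ _)
    exact (memLp_two_iff_integrable_sq (continuous_gridAmp a σ κ μ).aestronglyMeasurable).2
      (integrable_gridAmp_sq ha hσ κ μ)
  · intro f
    simp_rw [Complex.ofReal_mul, mul_assoc, Complex.ofReal_inv]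
    rw [integral_const_mul, integral_gridAmp_mul ha hσ]
    simp_rw [intervalIntegral.integral_const_mul]

theorem scale_pos (M n : ℕ) : 0 < scale M n := by
  unfold scale; positivity

theorem scale_succ (M n : ℕ) : scale M (n + 1) = √2 * scale M n := by
  unfold scale
  rw [← Real.sqrt_mul (by norm_num), ← zpow_one_add₀ (by norm_num)]
  congr 2
  push_cast
  ring

/-- The normalized momentum wave function of a von Mises grid state. -/
def gridWave (ξ Δ : ℝ) (M n : ℕ) (κ μ p : ℝ) : ℝ :=
  (normConst (scale M n * Δ) κ μ)⁻¹ * gridAmp (scale M n * ξ) (scale M n * Δ) κ μ p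

theorem isVonMisesGridState_iff {ξ Δ : ℝ} (hξ : 0 < ξ) (hΔ : 0 < Δ) (M n : ℕ) (κ μ : ℝ)
    (ψ : ℝ → ℂ) : IsVonMisesGridState ξ Δ M n κ μ ψ ↔
      ψ =ᵐ[volume] fun p => (gridWave ξ Δ M n κ μ p : ℂ) := by
  have h := isShiftedGridSuperposition_gridAmp (mul_pos (scale_pos M n) hξ)
    (mul_pos (scale_pos M n) hΔ) κ μ (normConst (scale M n * Δ) κ μ)
  exact ⟨fun hψ => hψ.ae_eq h, fun he => h.congr_ae he⟩

theorem integrable_gridWave_sq {ξ Δ : ℝ} (hξ : 0 < ξ) (hΔ : 0 < Δ) (M n : ℕ) (κ μ : ℝ) :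
    Integrable fun p => gridWave ξ Δ M n κ μ p ^ 2 := by
  simp_rw [gridWave, mul_pow]
  exact (integrable_gridAmp_sq (mul_pos (scale_pos M n) hξ)
    (mul_pos (scale_pos M n) hΔ) κ μ).const_mul _

theorem integral_gridWave_sq {ξ Δ : ℝ} (hξ : 0 < ξ) (hΔ : 0 < Δ) (M n : ℕ) (κ μ : ℝ) :
    ∫ p, gridWave ξ Δ M n κ μ p ^ 2 = 1 := by
  simp_rw [gridWave, mul_pow]
  rw [integral_const_mul, ← normConst_sq (mul_pos (scale_pos M n) hξ)
    (mul_pos (scale_pos M n) hΔ), ← mul_pow, inv_mul_cancel₀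
    (normConst_pos (mul_pos (scale_pos M n) hΔ) κ μ).ne', one_pow]

theorem quasiMeasurePreserving_div {c : ℝ} (hc : c ≠ 0) :
    Measure.QuasiMeasurePreserving (fun x : ℝ => x / c) volume volume := by
  refine ⟨by fun_prop, ?_⟩
  simp_rw [div_eq_inv_mul]
  rw [Real.map_volume_mul_left (inv_ne_zero hc)]
  exact Measure.smul_absolutelyContinuous

theorem beamSplitter_productState_ae {ψ₁ ψ₂ φ₁ φ₂ : ℝ → ℂ} (h₁ : ψ₁ =ᵐ[volume] φ₁)
    (h₂ : ψ₂ =ᵐ[volume] φ₂) (p : ℝ) :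
    ∀ᵐ P : ℝ, beamSplitter (productState ψ₁ ψ₂) (P, p) =
      φ₁ ((P - p) / √2) * φ₂ ((P + p) / √2) := by
  have q := quasiMeasurePreserving_div (c := √2) (by positivity)
  have e₁ := (q.comp (measurePreserving_sub_right volume p).quasiMeasurePreserving).ae h₁
  have e₂ := (q.comp (measurePreserving_add_right volume p).quasiMeasurePreserving).ae h₂
  filter_upwards [e₁, e₂] with P hP₁ hP₂
  simp only [Function.comp] at hP₁ hP₂
  simp only [beamSplitter, productState, hP₁, hP₂]

theorem measurePreserving_beamSplitter :
    MeasurePreserving (fun z : ℝ × ℝ => ((z.1 - z.2) / √2, (z.1 + z.2) / √2)) := by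
  refine ⟨by fun_prop, ?_⟩
  have hs : √2 * √2 = 2 := Real.mul_self_sqrt (by norm_num)
  have h2 : √2 ≠ 0 := by positivity
  set L := Matrix.toLin (Module.Basis.finTwoProd ℝ) (Module.Basis.finTwoProd ℝ)
    !![(√2)⁻¹, -(√2)⁻¹; (√2)⁻¹, (√2)⁻¹] with hL
  have hdet : LinearMap.det L = 1 := by
    rw [hL, LinearMap.det_toLin, Matrix.det_fin_two_of]
    field_simp
    nlinarith
  have hfun : (fun z : ℝ × ℝ => ((z.1 - z.2) / √2, (z.1 + z.2) / √2)) = L := by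
    ext z
    · rw [hL, Matrix.toLin_finTwoProd_apply]; simp only; ring
    · rw [hL, Matrix.toLin_finTwoProd_apply]; simp only; ring
  rw [hfun, Measure.map_linearMap_addHaar_eq_smul_addHaar _ (by rw [hdet]; exact one_ne_zero),
    hdet]
  simp

theorem integrable_and_integral_beamSplitter {F G : ℝ → ℝ} (hF : Integrable F)
    (hG : Integrable G) :
    Integrable (fun p : ℝ => ∫ P : ℝ, F ((P - p) / √2) * G ((P + p) / √2)) ∧
      ∫ p : ℝ, ∫ P : ℝ, F ((P - p) / √2) * G ((P + p) / √2) = (∫ x, F x) * ∫ x, G x := by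
  have hm := measurePreserving_beamSplitter
  have hFG : Integrable (fun z : ℝ × ℝ => F z.1 * G z.2) := hF.mul_prod hG
  have hi := hm.integrable_comp_of_integrable hFG
  refine ⟨hi.integral_prod_right, ?_⟩
  rw [← integral_prod_mul F G]
  refine (integral_prod_symm _ hi).symm.trans ?_
  have h := integral_map hm.measurable.aemeasurable (hm.map_eq.symm ▸ hFG.aestronglyMeasurable)
  rw [hm.map_eq] at h
  exact h.symm

theorem gridWave_mul_gridWave {ξ Δ : ℝ} (hξ : 0 < ξ) (hΔ : 0 < Δ) (M m : ℕ)
    (κ₁ κ₂ μ₁ μ₂ P p t : ℝ) (ht : t = rescaledOutcome ξ M (m + 1) p) :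
    gridWave ξ Δ M m κ₁ μ₁ ((P - p) / √2) * gridWave ξ Δ M m κ₂ μ₂ ((P + p) / √2) =
      ((normConst (scale M m * Δ) κ₁ μ₁)⁻¹ * (normConst (scale M m * Δ) κ₂ μ₂)⁻¹ *
        √(Δ / (√π * ξ) * besselI0 (kappaOut κ₁ κ₂ μ₁ μ₂ t) / (besselI0 κ₁ * besselI0 κ₂)) *
        Real.exp (-(Δ ^ 2 * p ^ 2 / (2 * ξ ^ 2)))) *
        gridAmp (scale M (m + 1) * ξ) (scale M (m + 1) * Δ) (kappaOut κ₁ κ₂ μ₁ μ₂ t)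
          (muOut κ₁ κ₂ μ₁ μ₂ t) P := by
  have hs := scale_pos M m
  have h := gridAmp_mul_gridAmp (mul_pos hs hξ) (mul_pos hs hΔ) κ₁ κ₂ μ₁ μ₂ P p t (by
    rw [ht, rescaledOutcome, scale_succ]; ring_nf)
  have e1 : scale M m * Δ / (√π * (scale M m * ξ)) = Δ / (√π * ξ) := by field_simp
  have e2 : (scale M m * Δ) ^ 2 * p ^ 2 / (2 * (scale M m * ξ) ^ 2) =
      Δ ^ 2 * p ^ 2 / (2 * ξ ^ 2) := by field_simp
  rw [e1, e2, ← mul_assoc, ← mul_assoc, ← scale_succ] at h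
  rw [gridWave, gridWave, mul_mul_mul_comm, h]
  ring

end GridBreeding

end

theorem mainTheorem1 (ξ Δ : ℝ) (hξ : 0 < ξ) (hΔ : 0 < Δ) (M m : ℕ) (κ₁ κ₂ μ₁ μ₂ : ℝ)
    (hκ₁ : 0 ≤ κ₁) (hκ₂ : 0 ≤ κ₂) :
    -- every state `|V_{κ, μ, n}⟩` is a well-defined unit vector of `L²(ℝ)`
    (∀ (n : ℕ) (κ μ : ℝ), 0 ≤ κ →
      0 < GridBreeding.normConst (GridBreeding.scale M n * Δ) κ μ ∧
      ∃ ψ : ℝ → ℂ, GridBreeding.IsVonMisesGridState ξ Δ M n κ μ ψ ∧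
        ∫ p : ℝ, ‖ψ p‖ ^ 2 = 1 ∧
        ∀ ψ' : ℝ → ℂ, GridBreeding.IsVonMisesGridState ξ Δ M n κ μ ψ' →
          ψ' =ᵐ[MeasureTheory.volume] ψ) ∧
    -- one round of breeding
    ∀ (ψ₁ ψ₂ : ℝ → ℂ) (Ψ : ℝ × ℝ → ℂ),
      GridBreeding.IsVonMisesGridState ξ Δ M m κ₁ μ₁ ψ₁ →
      GridBreeding.IsVonMisesGridState ξ Δ M m κ₂ μ₂ ψ₂ →
      Ψ = GridBreeding.beamSplitter (GridBreeding.productState ψ₁ ψ₂) →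
      (∀ pout t κout μout : ℝ,
        t = GridBreeding.rescaledOutcome ξ M (m + 1) pout →
        κout = GridBreeding.kappaOut κ₁ κ₂ μ₁ μ₂ t →
        μout = GridBreeding.muOut κ₁ κ₂ μ₁ μ₂ t →
        κout ^ 2 = κ₁ ^ 2 + κ₂ ^ 2 + 2 * κ₁ * κ₂ * Real.cos (μ₁ - μ₂ + 2 * t) ∧
        0 < GridBreeding.homodyneDensity Ψ pout ∧
        GridBreeding.homodyneDensity Ψ pout =
          Δ * GridBreeding.besselI0 κout *
              GridBreeding.normConst (GridBreeding.scale M (m + 1) * Δ) κout μout ^ 2 /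
            (√Real.pi * ξ * GridBreeding.besselI0 κ₁ * GridBreeding.besselI0 κ₂ *
              GridBreeding.normConst (GridBreeding.scale M m * Δ) κ₁ μ₁ ^ 2 *
              GridBreeding.normConst (GridBreeding.scale M m * Δ) κ₂ μ₂ ^ 2) *
            Real.exp (-(pout ^ 2 * Δ ^ 2 / ξ ^ 2)) ∧
        GridBreeding.IsVonMisesGridState ξ Δ M (m + 1) κout μout
          (GridBreeding.postMeasurementState Ψ pout)) ∧
      MeasureTheory.Integrable (GridBreeding.homodyneDensity Ψ) MeasureTheory.volume ∧
      ∫ pout : ℝ, GridBreeding.homodyneDensity Ψ pout = 1 := by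
  open MeasureTheory GridBreeding in
  refine ⟨fun n κ μ _ => ⟨normConst_pos (mul_pos (scale_pos M n) hΔ) κ μ,
    fun p => (gridWave ξ Δ M n κ μ p : ℂ), (isVonMisesGridState_iff hξ hΔ M n κ μ _).2
      Filter.EventuallyEq.rfl, ?_, fun ψ' h => (isVonMisesGridState_iff hξ hΔ M n κ μ _).1 h⟩, ?_⟩
  · simp only [Complex.norm_real, Real.norm_eq_abs, sq_abs]
    exact integral_gridWave_sq hξ hΔ M n κ μ
  intro ψ₁ ψ₂ Ψ hψ₁ hψ₂ hΨ
  rw [isVonMisesGridState_iff hξ hΔ] at hψ₁ hψ₂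
  have hae : ∀ p : ℝ, ∀ᵐ P : ℝ, Ψ (P, p) = ((gridWave ξ Δ M m κ₁ μ₁ ((P - p) / √2) *
      gridWave ξ Δ M m κ₂ μ₂ ((P + p) / √2) : ℝ) : ℂ) := by
    intro p
    simp_rw [hΨ, Complex.ofReal_mul]
    exact beamSplitter_productState_ae hψ₁ hψ₂ p
  have hdens : ∀ p : ℝ, homodyneDensity Ψ p = ∫ P : ℝ,
      (gridWave ξ Δ M m κ₁ μ₁ ((P - p) / √2) * gridWave ξ Δ M m κ₂ μ₂ ((P + p) / √2)) ^ 2 := by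
    intro p
    refine integral_congr_ae ?_
    filter_upwards [hae p] with P hP
    rw [hP, Complex.norm_real, Real.norm_eq_abs, sq_abs]
  refine ⟨?_, ?_⟩
  · intro p t κout μout ht hκ hμ
    have hs := scale_pos M m
    have hs' := scale_pos M (m + 1)
    have hN₁ := normConst_pos (mul_pos hs hΔ) κ₁ μ₁
    have hN₂ := normConst_pos (mul_pos hs hΔ) κ₂ μ₂
    have hN := normConst_pos (mul_pos hs' hΔ) κout μout
    have hI₁ := besselI0_pos κ₁
    have hI₂ := besselI0_pos κ₂
    have hI := besselI0_pos κout
    have hmul := fun P => gridWave_mul_gridWave hξ hΔ M m κ₁ κ₂ μ₁ μ₂ P p t ht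
    simp_rw [← hκ, ← hμ] at hmul
    set B := (normConst (scale M m * Δ) κ₁ μ₁)⁻¹ * (normConst (scale M m * Δ) κ₂ μ₂)⁻¹ *
        √(Δ / (√Real.pi * ξ) * besselI0 κout / (besselI0 κ₁ * besselI0 κ₂)) *
        Real.exp (-(Δ ^ 2 * p ^ 2 / (2 * ξ ^ 2))) with hB
    have hBpos : 0 < B := by positivity
    have hd : homodyneDensity Ψ p =
        (B * normConst (scale M (m + 1) * Δ) κout μout) ^ 2 := by
      rw [hdens]
      simp_rw [hmul, mul_pow]
      rw [MeasureTheory.integral_const_mul,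
        ← normConst_sq (mul_pos hs' hξ) (mul_pos hs' hΔ)]
    refine ⟨by rw [hκ]; exact kappaOut_sq κ₁ κ₂ μ₁ μ₂ t, by rw [hd]; positivity, ?_, ?_⟩
    · rw [hd, hB, mul_pow, mul_pow, mul_pow, mul_pow, Real.sq_sqrt (by positivity),
        ← Real.exp_nat_mul]
      have e : ((2 : ℕ) : ℝ) * -(Δ ^ 2 * p ^ 2 / (2 * ξ ^ 2)) = -(p ^ 2 * Δ ^ 2 / ξ ^ 2) := by
        push_cast; field_simp
      rw [e]
      field_simp
    · rw [isVonMisesGridState_iff hξ hΔ]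
      filter_upwards [hae p] with P hP
      rw [postMeasurementState, hP, hd, Real.sqrt_sq (by positivity), hmul, gridWave,
        ← Complex.ofReal_inv, ← Complex.ofReal_mul]
      congr 1
      field_simp
  · have h := integrable_and_integral_beamSplitter (integrable_gridWave_sq hξ hΔ M m κ₁ μ₁)
      (integrable_gridWave_sq hξ hΔ M m κ₂ μ₂)
    simp_rw [← mul_pow, ← hdens, integral_gridWave_sq hξ hΔ, mul_one] at h
    exact h
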